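/- Let $0<y<\tfrac12$ and let $\Gamma=\{e^{i\theta} : -\pi y\le\theta\le\pi y\}$ be the circle arc of length $L=2\pi y$, with the normalized arclength inner product \[ \langle f,g\rangle=\frac1L\int_\Gamma f(z)\,\overline{g(z)}\,|dz|=\frac1{2\pi y}\int_{-\pi y}^{\pi y} f(e^{i\theta})\,\overline{g(e^{i\theta})}\,d\theta . \] Let $p_0,p_1,p_2,\dots$ be the orthonormal (Szegő) polynomials on $\Gamma$, obtained by applying the Gram–Schmidt procedure to the monomials $1,z,z^2,\dots$ with respect to $\langle\cdot,\cdot\rangle$. Then for every integer $n\ge 0$ the polynomial $p_n$ has degree $n$, its leading coefficient $k_n$ (the coefficient of $z^n$) is a positive real number, and, with $c=\sin\frac{\pi y}{2}$, \[ \frac{c}{2y}\,c^{2n}\;\le\;k_n^{-2}\;\le\;4(1+2y)^2\,c^{2n}. \] -/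

import Mathlib

open scoped Polynomial

namespace SzegoArc

noncomputable section

/-- The normalised arclength inner product `(1/L) ∫_Γ f(z) conj (g(z)) |dz|` on the circle arc
`Γ = {e^{iθ} : -πy ≤ θ ≤ πy}` of length `L = 2πy`, parametrised by the angle `θ`, on which
`|dz| = dθ`. -/
def arcInner (y : ℝ) (f g : ℂ → ℂ) : ℂ :=
  (1 / (2 * Real.pi * y) : ℝ) *
    ∫ θ in (-(Real.pi * y))..(Real.pi * y),
      f (Complex.exp (θ * Complex.I)) *
        (starRingEnd ℂ) (g (Complex.exp (θ * Complex.I)))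

/-- The norm `‖f‖ = √⟨f, f⟩`. -/
def arcNorm (y : ℝ) (f : ℂ → ℂ) : ℝ :=
  Real.sqrt (arcInner y f f).re

/-- Gram-Schmidt orthogonalisation (before normalisation) of the monomials `1, z, z², …`. -/
def monicSzego (y : ℝ) (n : ℕ) : ℂ[X] :=
  Polynomial.X ^ n - ∑ m : Fin n,
    Polynomial.C (arcInner y (fun z => z ^ n) (fun z => (monicSzego y m).eval z) /
      arcInner y (fun z => (monicSzego y m).eval z) (fun z => (monicSzego y m).eval z)) *
        monicSzego y m
termination_by n
decreasing_by all_goals exact m.isLt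

/-- The orthonormal (Szegő) polynomials `p_n` on the arc `Γ`. -/
def szegoPoly (y : ℝ) (n : ℕ) : ℂ[X] :=
  Polynomial.C (((arcNorm y (fun z => (monicSzego y n).eval z))⁻¹ : ℝ) : ℂ) * monicSzego y n

/-! Consistency of the definitions: the polynomials `p_n` have degree `n` and are orthonormal. -/

theorem monicSzego_degree_sub (y : ℝ) (n : ℕ) :
    (Polynomial.X ^ n - monicSzego y n).degree < (n : WithBot ℕ) := by
  induction n using Nat.strong_induction_on with
  | _ n ih =>
    rw [monicSzego, sub_sub_cancel]
    refine Polynomial.mem_degreeLT.1 (Submodule.sum_mem _ fun m _ => Polynomial.mem_degreeLT.2 ?_)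
    rw [← Polynomial.smul_eq_C_mul]
    refine lt_of_le_of_lt (Polynomial.degree_smul_le _ _) ?_
    have h1 := ih m m.isLt
    have h2 : monicSzego y m
        = Polynomial.X ^ (m : ℕ) - (Polynomial.X ^ (m : ℕ) - monicSzego y m) := by ring
    have hm : ((m : ℕ) : WithBot ℕ) < (n : WithBot ℕ) := by exact_mod_cast m.isLt
    rw [h2]
    refine lt_of_le_of_lt (Polynomial.degree_sub_le _ _) (max_lt ?_ (h1.trans hm))
    rw [Polynomial.degree_X_pow]
    exact hm

theorem monicSzego_monic (y : ℝ) (n : ℕ) : (monicSzego y n).Monic := by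
  have h := monicSzego_degree_sub y n
  have h2 : monicSzego y n = Polynomial.X ^ n + -(Polynomial.X ^ n - monicSzego y n) := by ring
  rw [h2]
  exact Polynomial.monic_X_pow_add (by rwa [Polynomial.degree_neg])

theorem monicSzego_natDegree (y : ℝ) (n : ℕ) : (monicSzego y n).natDegree = n := by
  have h := monicSzego_degree_sub y n
  have h2 : monicSzego y n = Polynomial.X ^ n + -(Polynomial.X ^ n - monicSzego y n) := by ring
  rw [h2]
  exact Polynomial.natDegree_eq_of_degree_eq_some (by
    rw [Polynomial.degree_add_eq_left_of_degree_lt] <;>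
      simp only [Polynomial.degree_X_pow, Polynomial.degree_neg]
    exact h)

theorem arcInner_conj (y : ℝ) (f g : ℂ → ℂ) :
    (starRingEnd ℂ) (arcInner y f g) = arcInner y g f := by
  unfold arcInner
  rw [map_mul, Complex.conj_ofReal, ← intervalIntegral.intervalIntegral_conj]
  congr 2
  ext θ
  simp [mul_comm]

theorem arcInner_sub (y : ℝ) (p q r : ℂ[X]) :
    arcInner y (fun z => (p - q).eval z) (fun z => r.eval z)
      = arcInner y (fun z => p.eval z) (fun z => r.eval z)
        - arcInner y (fun z => q.eval z) (fun z => r.eval z) := by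
  unfold arcInner
  rw [← mul_sub, ← intervalIntegral.integral_sub]
  · simp [sub_mul]
  all_goals
    apply Continuous.intervalIntegrable
    fun_prop

theorem arcInner_C_mul (y : ℝ) (a : ℂ) (p r : ℂ[X]) :
    arcInner y (fun z => (Polynomial.C a * p).eval z) (fun z => r.eval z)
      = a * arcInner y (fun z => p.eval z) (fun z => r.eval z) := by
  unfold arcInner
  rw [mul_left_comm, ← intervalIntegral.integral_const_mul]
  simp [mul_assoc]

theorem arcInner_sum (y : ℝ) {ι : Type} (s : Finset ι) (p : ι → ℂ[X]) (r : ℂ[X]) :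
    arcInner y (fun z => (∑ i ∈ s, p i).eval z) (fun z => r.eval z)
      = ∑ i ∈ s, arcInner y (fun z => (p i).eval z) (fun z => r.eval z) := by
  unfold arcInner
  rw [← Finset.mul_sum, ← intervalIntegral.integral_finsetSum]
  · simp [Polynomial.eval_finsetSum, Finset.sum_mul]
  · intro i _
    apply Continuous.intervalIntegrable
    fun_prop

theorem arcInner_self (y : ℝ) (f : ℂ → ℂ) :
    arcInner y f f = ((1 / (2 * Real.pi * y) *
      ∫ θ in (-(Real.pi * y))..(Real.pi * y),
        ‖f (Complex.exp (θ * Complex.I))‖ ^ 2 : ℝ) : ℂ) := by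
  unfold arcInner
  rw [Complex.ofReal_mul, ← intervalIntegral.integral_ofReal]
  congr 2
  ext θ
  rw [Complex.mul_conj, Complex.normSq_eq_norm_sq]

theorem arcInner_self_pos (y : ℝ) (hy : 0 < y) (hy' : y < 1) (p : ℂ[X]) (hp : p ≠ 0) :
    0 < (arcInner y (fun z => p.eval z) (fun z => p.eval z)).re := by
  rw [arcInner_self, Complex.ofReal_re]
  have hpi := Real.pi_pos
  have hab : -(Real.pi * y) < Real.pi * y := by nlinarith [mul_pos hpi hy]
  refine mul_pos (by positivity) (intervalIntegral.integral_pos hab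
    (Continuous.continuousOn (by fun_prop)) (fun θ _ => by positivity) ?_)
  by_contra! hcon
  apply hp
  refine Polynomial.eq_zero_of_infinite_isRoot p (Set.Infinite.mono (s :=
    (fun θ : ℝ => Complex.exp (θ * Complex.I)) '' Set.Icc (-(Real.pi * y)) (Real.pi * y)) ?_ ?_)
  · rintro _ ⟨θ, hθ, rfl⟩
    have h := hcon θ hθ
    have h0 : ‖p.eval (Complex.exp (θ * Complex.I))‖ = 0 := by
      have := le_antisymm h (by positivity)
      simpa using this
    simpa [Polynomial.IsRoot] using h0
  · refine Set.Infinite.image ?_ (Set.Icc_infinite hab)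
    have hlt : Real.pi * y < Real.pi := by nlinarith
    intro s hs t ht hst
    have := congrArg Complex.arg hst
    simp only at this
    rwa [Complex.arg_exp_mul_I, Complex.arg_exp_mul_I,
      (toIocMod_eq_self _).2 ⟨by linarith [hs.1], by linarith [hs.2]⟩,
      (toIocMod_eq_self _).2 ⟨by linarith [ht.1], by linarith [ht.2]⟩] at this

theorem monicSzego_orthogonal (y : ℝ) (hy : 0 < y) (hy' : y < 1) (n : ℕ) :
    ∀ m < n, arcInner y (fun z => (monicSzego y n).eval z)
      (fun z => (monicSzego y m).eval z) = 0 := by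
  induction n using Nat.strong_induction_on with
  | _ n ih =>
    intro m hm
    rw [show monicSzego y n = _ from by rw [monicSzego], arcInner_sub, arcInner_sum]
    simp only [arcInner_C_mul]
    rw [Finset.sum_eq_single (⟨m, hm⟩ : Fin n)]
    · have hne : arcInner y (fun z => (monicSzego y m).eval z)
          (fun z => (monicSzego y m).eval z) ≠ 0 := fun h => by
        have := arcInner_self_pos y hy hy' _ (monicSzego_monic y m).ne_zero
        rw [h] at this
        simp at this
      rw [div_mul_cancel₀ _ hne]
      simp
    · intro j _ hj
      have hj' : (j : ℕ) ≠ m := fun h => hj (Fin.ext h)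
      rcases lt_or_gt_of_ne hj' with h | h
      · rw [← arcInner_conj y (fun z => (monicSzego y m).eval z), ih m hm j h]
        simp
      · rw [ih j j.isLt m h]
        simp
    · simp

theorem szegoPoly_orthonormal (y : ℝ) (hy : 0 < y) (hy' : y < 1) (m n : ℕ) :
    arcInner y (fun z => (szegoPoly y m).eval z) (fun z => (szegoPoly y n).eval z)
      = if m = n then 1 else 0 := by
  have hr : ∀ (a : ℝ) (p r : ℂ[X]),
      arcInner y (fun z => p.eval z) (fun z => (Polynomial.C (a : ℂ) * r).eval z)
        = a * arcInner y (fun z => p.eval z) (fun z => r.eval z) := by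
    intro a p r
    rw [← arcInner_conj, arcInner_C_mul, map_mul, Complex.conj_ofReal, arcInner_conj]
  unfold szegoPoly
  rw [arcInner_C_mul, hr]
  split_ifs with h
  · subst h
    have hpos := arcInner_self_pos y hy hy' _ (monicSzego_monic y m).ne_zero
    have hre : arcInner y (fun z => (monicSzego y m).eval z) (fun z => (monicSzego y m).eval z)
        = ((arcNorm y (fun z => (monicSzego y m).eval z) ^ 2 : ℝ) : ℂ) := by
      unfold arcNorm
      rw [Real.sq_sqrt hpos.le, arcInner_self, Complex.ofReal_re]
    have hne : arcNorm y (fun z => (monicSzego y m).eval z) ≠ 0 :=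
      (Real.sqrt_pos.2 hpos).ne'
    rw [hre, ← Complex.ofReal_mul, ← Complex.ofReal_mul]
    norm_cast
    field_simp
  · rcases lt_or_gt_of_ne h with h | h
    · rw [← arcInner_conj, monicSzego_orthogonal y hy hy' n m h]
      simp
    · rw [monicSzego_orthogonal y hy hy' m n h]
      simp

end

end SzegoArc

open scoped Polynomial

namespace SzegoArc

/-! Since `szegoPoly` is `monicSzego` divided by its norm, `k⁻²` is the squared norm of `monicSzego
y n`, the least among monic polynomials of degree `n` (`arcInner_monicSzego_le`).

Upper bound: test this with `arcChebyshev c n`, of modulus at most `2 cⁿ` on the arc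
(`norm_arcChebyshev_le`).

Lower bound, for any monic `P`: put `sin (θ/2) = c sin t`, `z = e^{iθ}`, `w = e^{2it}`. Then `P(z)
P(1/z) = c^{2n} F(w) F(1/w)` for a polynomial `F` with `|F(0)| ≥ 1` (`exists_arc_factor`). As `dθ ≥
2c cos t dt` and `|P(z)|² + |P(1/z)|² ≥ 2 |P(z) P(1/z)|`, it remains to bound the mean of `|F(w)
F(1/w)| cos t`. This is the modulus of a polynomial in `w`, up to a factor 2, so its value at `0`
bounds the mean from below. -/

/-! ### Extremal property of the monic orthogonal polynomials. -/

/-- `monicSzego y n` is orthogonal to every polynomial of degree less than `n`. -/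
theorem arcInner_monicSzego_eq_zero (y : ℝ) (hy : 0 < y) (hy' : y < 1) (n : ℕ) (q : ℂ[X])
    (hq : q.degree < n) :
    arcInner y (fun z => q.eval z) (fun z => (monicSzego y n).eval z) = 0 := by
  have key : ∀ k ≤ n, ∀ q : ℂ[X], q.degree < k →
      arcInner y (fun z => q.eval z) (fun z => (monicSzego y n).eval z) = 0 := by
    intro k
    induction k with
    | zero =>
      intro _ q hq
      have : q = 0 := by simpa [Polynomial.degree_lt_iff_coeff_zero, Polynomial.ext_iff] using hq
      simp [this, arcInner]
    | succ k ih =>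
      intro hk q hq
      have hr : (q - Polynomial.C (q.coeff k) * monicSzego y k).degree < k := by
        rw [Polynomial.degree_lt_iff_coeff_zero] at hq ⊢
        intro m hm
        rcases hm.eq_or_lt with rfl | hm
        · have h1 : (monicSzego y k).coeff k = 1 := by
            simpa [Polynomial.Monic, Polynomial.leadingCoeff, monicSzego_natDegree]
              using monicSzego_monic y k
          simp [h1]
        · rw [Polynomial.coeff_sub, Polynomial.coeff_C_mul, hq m hm,
            Polynomial.coeff_eq_zero_of_natDegree_lt (p := monicSzego y k)
              (by rwa [monicSzego_natDegree])]
          simp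
      have h0 := ih (by omega) _ hr
      rw [arcInner_sub, arcInner_C_mul,
        ← arcInner_conj y (fun z => (monicSzego y n).eval z) (fun z => (monicSzego y k).eval z),
        monicSzego_orthogonal y hy hy' n k (by omega)] at h0
      simpa using h0
  exact key n le_rfl q hq

theorem arcInner_self_nonneg (y : ℝ) (hy : 0 < y) (f : ℂ → ℂ) : 0 ≤ (arcInner y f f).re := by
  rw [arcInner_self, Complex.ofReal_re]
  have hpi := Real.pi_pos
  have := intervalIntegral.integral_nonneg (μ := MeasureTheory.volume)
    (f := fun θ : ℝ => ‖f (Complex.exp (θ * Complex.I))‖ ^ 2)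
    (show -(Real.pi * y) ≤ Real.pi * y by nlinarith [mul_pos hpi hy]) (fun θ _ => by positivity)
  positivity

/-- `monicSzego y n` has least norm among the monic polynomials of degree `n`. -/
theorem arcInner_monicSzego_le (y : ℝ) (hy : 0 < y) (hy' : y < 1) (Q : ℂ[X]) (hQ : Q.Monic) :
    (arcInner y (fun z => (monicSzego y Q.natDegree).eval z)
        (fun z => (monicSzego y Q.natDegree).eval z)).re
      ≤ (arcInner y (fun z => Q.eval z) (fun z => Q.eval z)).re := by
  set p := monicSzego y Q.natDegree with hp
  have hpd : p.natDegree = Q.natDegree := monicSzego_natDegree y _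
  have hpm : p.Monic := monicSzego_monic y _
  have hdeg : (Q - p).degree < (Q.natDegree : WithBot ℕ) := by
    rw [← Polynomial.degree_eq_natDegree hQ.ne_zero]
    refine Polynomial.degree_sub_lt_left ?_ hQ.ne_zero (by rw [hQ, hpm])
    rw [Polynomial.degree_eq_natDegree hQ.ne_zero, Polynomial.degree_eq_natDegree hpm.ne_zero, hpd]
  have h1 := arcInner_monicSzego_eq_zero y hy hy' _ (Q - p) hdeg
  have h2 := arcInner_self_nonneg y hy (fun z => (Q - p).eval z)
  have h3 := arcInner_conj y (fun z => (Q - p).eval z) (fun z => p.eval z)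
  rw [← hp] at h1
  rw [h1, map_zero] at h3
  rw [arcInner_sub, ← h3, sub_zero, ← arcInner_conj, arcInner_sub, Complex.conj_re,
    Complex.sub_re, ← arcInner_conj y (fun z => Q.eval z) (fun z => p.eval z),
    Complex.conj_re] at h2
  rw [arcInner_sub] at h1
  have h4 := congrArg Complex.re h1
  simp only [Complex.sub_re, Complex.zero_re] at h4
  linarith

/-! ### Upper bound from Chebyshev-type polynomials on the arc. -/

/-- The Chebyshev-type polynomials `2 (ci)ⁿ z^{n/2} Tₙ(sin (θ/2) / c)`, `z = e^{iθ}`. -/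
noncomputable def arcChebyshev (c : ℝ) : ℕ → ℂ[X]
  | 0 => 2
  | 1 => Polynomial.X - 1
  | n + 2 => (Polynomial.X - 1) * arcChebyshev c (n + 1) +
      Polynomial.C ((c : ℂ) ^ 2) * Polynomial.X * arcChebyshev c n

/-- The recurrence has characteristic polynomial `x² - (z - 1) x - c² z`, whose roots are `a` and
`b`. -/
theorem arcChebyshev_eval (c : ℝ) {z a b : ℂ} (hs : a + b = z - 1) (hp : a * b = -c ^ 2 * z)
    (n : ℕ) : (arcChebyshev c n).eval z = a ^ n + b ^ n := by
  induction n using Nat.twoStepInduction with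
  | zero => simp [arcChebyshev]; norm_num
  | one => simp [arcChebyshev, hs]
  | more n h0 h1 =>
    simp only [arcChebyshev, Polynomial.eval_add, Polynomial.eval_mul, h0, h1,
      Polynomial.eval_sub, Polynomial.eval_X, Polynomial.eval_one, Polynomial.eval_C]
    rw [← hs, show (c : ℂ) ^ 2 * z = -(a * b) by rw [hp]; ring]
    ring

theorem arcChebyshev_monic_natDegree (c : ℝ) (n : ℕ) :
    (arcChebyshev c n).natDegree ≤ n ∧ (1 ≤ n → (arcChebyshev c n).coeff n = 1) := by
  induction n using Nat.twoStepInduction with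
  | zero => simp [arcChebyshev]
  | one =>
    refine ⟨?_, fun _ => ?_⟩
    · simpa [arcChebyshev] using (Polynomial.natDegree_X_sub_C (1 : ℂ)).le
    · simp [arcChebyshev, Polynomial.coeff_one]
  | more n h0 h1 =>
    have hX : (Polynomial.X - 1 : ℂ[X]).natDegree ≤ 1 := by
      simpa using (Polynomial.natDegree_X_sub_C (1 : ℂ)).le
    have hCX : (Polynomial.C ((c : ℂ) ^ 2) * Polynomial.X).natDegree ≤ 1 :=
      (Polynomial.natDegree_C_mul_le _ _).trans Polynomial.natDegree_X_le
    have hB := Polynomial.natDegree_mul_le_of_le hCX h0.1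
    refine ⟨?_, fun _ => ?_⟩
    · rw [arcChebyshev]
      refine (Polynomial.natDegree_add_le_of_le
        (Polynomial.natDegree_mul_le_of_le hX h1.1) hB).trans ?_
      omega
    · rw [arcChebyshev, Polynomial.coeff_add,
        Polynomial.coeff_eq_zero_of_natDegree_lt (lt_of_le_of_lt hB (by omega)), sub_mul,
        one_mul, Polynomial.coeff_sub, Polynomial.coeff_X_mul, h1.2 (by omega),
        Polynomial.coeff_eq_zero_of_natDegree_lt (lt_of_le_of_lt h1.1 (by omega))]
      simp

theorem arcChebyshev_natDegree (c : ℝ) {n : ℕ} (hn : 1 ≤ n) : (arcChebyshev c n).natDegree = n :=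
  Polynomial.natDegree_eq_of_le_of_coeff_ne_zero (arcChebyshev_monic_natDegree c n).1
    (by simp [(arcChebyshev_monic_natDegree c n).2 hn])

theorem arcChebyshev_monic (c : ℝ) {n : ℕ} (hn : 1 ≤ n) : (arcChebyshev c n).Monic := by
  rw [Polynomial.Monic, Polynomial.leadingCoeff, arcChebyshev_natDegree c hn]
  exact (arcChebyshev_monic_natDegree c n).2 hn

/-- On the arc both characteristic roots have modulus `c`: they are `c i e^{iθ/2} e^{±iφ}` with `cos
φ = sin (θ/2) / c`. -/
theorem norm_arcChebyshev_le {c θ : ℝ} (hc : 0 < c) (hθ : |Real.sin (θ / 2)| ≤ c) (n : ℕ) :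
    ‖(arcChebyshev c n).eval (Complex.exp (θ * Complex.I))‖ ≤ 2 * c ^ n := by
  obtain ⟨h1, h2⟩ := abs_le.1 hθ
  set φ := Real.arccos (Real.sin (θ / 2) / c) with hφ
  have hcos : c * Real.cos φ = Real.sin (θ / 2) := by
    rw [hφ, Real.cos_arccos]
    · field_simp
    · rw [le_div_iff₀ hc]; linarith
    · rw [div_le_iff₀ hc]; linarith
  have hcos' : (c : ℂ) * Complex.cos φ = Complex.sin (θ / 2) := by exact_mod_cast hcos
  set a := (c : ℂ) * Complex.I * Complex.exp ((θ / 2 : ℝ) * Complex.I) *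
    Complex.exp (φ * Complex.I) with ha
  set b := (c : ℂ) * Complex.I * Complex.exp ((θ / 2 : ℝ) * Complex.I) *
    Complex.exp ((-φ : ℝ) * Complex.I) with hb
  have hna : ‖a‖ = c := by
    rw [ha, norm_mul, norm_mul, norm_mul, Complex.norm_exp_ofReal_mul_I,
      Complex.norm_exp_ofReal_mul_I]
    simp [abs_of_pos hc]
  have hnb : ‖b‖ = c := by
    rw [hb, norm_mul, norm_mul, norm_mul, Complex.norm_exp_ofReal_mul_I,
      Complex.norm_exp_ofReal_mul_I]
    simp [abs_of_pos hc]
  have hz : Complex.exp (θ * Complex.I) = Complex.exp ((θ / 2 : ℝ) * Complex.I) *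
      Complex.exp ((θ / 2 : ℝ) * Complex.I) := by
    rw [← Complex.exp_add]; push_cast; ring_nf
  have hinv : Complex.exp ((θ / 2 : ℝ) * Complex.I) * Complex.exp (-(θ / 2 : ℝ) * Complex.I)
      = 1 := by
    rw [← Complex.exp_add]; simp
  have hφ1 : Complex.exp (φ * Complex.I) * Complex.exp ((-φ : ℝ) * Complex.I) = 1 := by
    rw [← Complex.exp_add]; simp
  have hsum : a + b = Complex.exp (θ * Complex.I) - 1 := by
    have e1 : a + b = 2 * Complex.I * Complex.exp ((θ / 2 : ℝ) * Complex.I) *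
        (c * Complex.cos φ) := by
      rw [ha, hb, Complex.cos]; push_cast; ring
    rw [e1, hcos', Complex.sin, hz, ← hinv]
    push_cast
    linear_combination (-Complex.exp (θ / 2 * Complex.I) * (Complex.exp (θ / 2 * Complex.I) -
      Complex.exp (-(θ / 2) * Complex.I))) * Complex.I_sq
  have hprod : a * b = -c ^ 2 * Complex.exp (θ * Complex.I) := by
    rw [ha, hb, hz]
    linear_combination (c ^ 2 * Complex.I ^ 2 * Complex.exp ((θ / 2 : ℝ) * Complex.I) ^ 2) * hφ1 +
      (c ^ 2 * Complex.exp ((θ / 2 : ℝ) * Complex.I) ^ 2) * Complex.I_sq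
  rw [arcChebyshev_eval c hsum hprod]
  refine (norm_add_le _ _).trans ?_
  rw [norm_pow, norm_pow, hna, hnb]
  linarith

theorem abs_sin_half_le {y θ : ℝ} (hy1 : y < 1 / 2)
    (hθ : θ ∈ Set.Icc (-(Real.pi * y)) (Real.pi * y)) :
    |Real.sin (θ / 2)| ≤ Real.sin (Real.pi * y / 2) := by
  have hpi := Real.pi_pos
  have h : Real.pi * y < Real.pi := by nlinarith
  rw [abs_le, ← Real.sin_neg]
  constructor <;> apply Real.sin_le_sin_of_le_of_le_pi_div_two <;> linarith [hθ.1, hθ.2]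

theorem arcInner_monicSzego_le_four_mul {y : ℝ} (hy0 : 0 < y) (hy1 : y < 1 / 2) (n : ℕ) :
    (arcInner y (fun z => (monicSzego y n).eval z) (fun z => (monicSzego y n).eval z)).re
      ≤ 4 * Real.sin (Real.pi * y / 2) ^ (2 * n) := by
  have hpi := Real.pi_pos
  have hpy : 0 < Real.pi * y := by positivity
  have hc : 0 < Real.sin (Real.pi * y / 2) :=
    Real.sin_pos_of_pos_of_lt_pi (by positivity) (by nlinarith)
  -- The inner product is normalised to total mass one, so a pointwise bound passes to the norm.
  have hle : ∀ (f : ℂ[X]) (M : ℝ), (∀ θ ∈ Set.Icc (-(Real.pi * y)) (Real.pi * y),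
      ‖f.eval (Complex.exp (θ * Complex.I))‖ ^ 2 ≤ M) →
      (arcInner y (fun z => f.eval z) (fun z => f.eval z)).re ≤ M := by
    intro f M hM
    rw [arcInner_self, Complex.ofReal_re]
    have := intervalIntegral.integral_mono_on (μ := MeasureTheory.volume)
      (by linarith : -(Real.pi * y) ≤ Real.pi * y)
      (Continuous.intervalIntegrable (by fun_prop) _ _) (by simp) hM
    rw [intervalIntegral.integral_const, smul_eq_mul] at this
    rw [one_div, inv_mul_le_iff₀ (by positivity)]
    linarith
  rcases Nat.eq_zero_or_pos n with rfl | hn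
  -- Degree zero is separate because `arcChebyshev c 0 = 2` is not monic.
  · have h1 : monicSzego y 0 = 1 := by rw [monicSzego]; simp
    rw [h1]
    exact hle 1 _ fun θ _ => by simp
  · have h := arcInner_monicSzego_le y hy0 (by linarith) _
      (arcChebyshev_monic (Real.sin (Real.pi * y / 2)) hn)
    rw [arcChebyshev_natDegree _ hn] at h
    refine h.trans (hle _ _ fun θ hθ => ?_)
    have h2 := norm_arcChebyshev_le hc (abs_sin_half_le hy1 hθ) n
    calc _ ≤ (2 * Real.sin (Real.pi * y / 2) ^ n) ^ 2 := by gcongr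
      _ = _ := by ring

/-! ### Factorisation of `P(z) P(1/z)` in the variable `w`. -/

/-- These equations make `(z - a)(1/z - a) = c² (v + v'w)(v + v'/w)`: the two sides are `(1 - a)² +
a (2 - z - 1/z)` and `c² (v + v')² - c² v v' (2 - w - 1/w)`. -/
theorem exists_one_le_norm_root_pair {c : ℝ} (hc0 : 0 < c) (hc1 : c < 1) (a : ℂ) :
    ∃ v v' : ℂ, 1 ≤ ‖v‖ ∧ c * (v + v') = 1 - a ∧ v * v' = -a := by
  have hc : (c : ℂ) ≠ 0 := by exact_mod_cast hc0.ne'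
  obtain ⟨v, hv⟩ := exists_quadratic_eq_zero (a := (c : ℂ)) (b := -(1 - a)) (c := -(a * c)) hc
    (IsAlgClosed.exists_eq_mul_self _)
  set v' := (1 - a) / c - v with hv'
  have hsum : c * (v + v') = 1 - a := by rw [hv']; field_simp; ring
  have hprod : v * v' = -a := by
    apply mul_left_cancel₀ hc
    linear_combination v * hsum - hv
  rcases le_or_gt 1 ‖v‖ with h | h
  · exact ⟨v, v', h, hsum, hprod⟩
  · refine ⟨v', v, ?_, by rw [add_comm, hsum], by rw [mul_comm, hprod]⟩
    -- Thus `v'` is minus the reciprocal of the Blaschke factor `(v - c)/(1 - cv)`, which is at most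
    -- `1` in modulus on the disc.
    have he : v' * (v - c) = -(1 - c * v) := by linear_combination hprod - hsum
    have hnorm : ‖v'‖ * ‖v - c‖ = ‖1 - c * v‖ := by rw [← norm_mul, he, norm_neg]
    have hle : ‖v - c‖ ≤ ‖1 - c * v‖ := by
      apply le_of_sq_le_sq _ (norm_nonneg _)
      have h2 : v.re * v.re + v.im * v.im < 1 := by
        rw [← Complex.normSq_apply, Complex.normSq_eq_norm_sq]
        nlinarith [norm_nonneg v]
      rw [← Complex.normSq_eq_norm_sq, ← Complex.normSq_eq_norm_sq, Complex.normSq_apply,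
        Complex.normSq_apply]
      simp
      -- The identity is `|1 - cv|² - |v - c|² = (1 - c²)(1 - |v|²)`.
      nlinarith [mul_pos (sub_pos.2 h2) (show 0 < 1 - c ^ 2 by nlinarith)]
    have hne : 0 < ‖v - c‖ := by
      rw [norm_pos_iff]
      intro h0
      have hvc : v = c := sub_eq_zero.1 h0
      rw [h0, mul_zero, hvc] at he
      have : (c : ℂ) * c = 1 := by linear_combination -he
      have : c * c = 1 := by exact_mod_cast this
      nlinarith
    by_contra! hlt
    nlinarith

/-- On an arc of capacity `c` the product `P(z) P(1/z)` of a monic polynomial factors through the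
variable `w` of `2 - z - 1/z = c² (2 - w - 1/w)`. -/
theorem exists_arc_factor {c : ℝ} (hc0 : 0 < c) (hc1 : c < 1) (P : ℂ[X]) (hP : P.Monic) :
    ∃ F : ℂ[X], 1 ≤ ‖F.eval 0‖ ∧ ∀ z w : ℂ, z ≠ 0 → w ≠ 0 →
      2 - z - z⁻¹ = c ^ 2 * (2 - w - w⁻¹) →
      P.eval z * P.eval z⁻¹ = c ^ (2 * P.natDegree) * (F.eval w * F.eval w⁻¹) := by
  have key : ∀ s : Multiset ℂ, ∃ F : ℂ[X], 1 ≤ ‖F.eval 0‖ ∧ ∀ z w : ℂ, z ≠ 0 → w ≠ 0 →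
      2 - z - z⁻¹ = c ^ 2 * (2 - w - w⁻¹) →
      (s.map fun a => z - a).prod * (s.map fun a => z⁻¹ - a).prod
        = c ^ (2 * s.card) * (F.eval w * F.eval w⁻¹) := by
    intro s
    induction s using Multiset.induction_on with
    | empty => exact ⟨1, by simp, by simp⟩
    | cons a s ih =>
      obtain ⟨F, hF0, hF⟩ := ih
      obtain ⟨v, v', hv, hsum, hprod⟩ := exists_one_le_norm_root_pair hc0 hc1 a
      refine ⟨(Polynomial.C v + Polynomial.C v' * Polynomial.X) * F, ?_, ?_⟩
      · simp only [Polynomial.eval_mul, Polynomial.eval_add, Polynomial.eval_C,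
          Polynomial.eval_X, mul_zero, add_zero, norm_mul]
        nlinarith
      · intro z w hz hw hzw
        have h := hF z w hz hw hzw
        have h1 : (z - a) * (z⁻¹ - a) = c ^ 2 * ((v + v' * w) * (v + v' * w⁻¹)) := by
          have hz' := mul_inv_cancel₀ hz
          have hw' := mul_inv_cancel₀ hw
          linear_combination hz' - c ^ 2 * v' ^ 2 * hw' + a * hzw
            - (1 - a + c * (v + v')) * hsum + c ^ 2 * (2 - w - w⁻¹) * hprod
        simp only [Multiset.map_cons, Multiset.prod_cons, Multiset.card_cons,
          Polynomial.eval_mul, Polynomial.eval_add, Polynomial.eval_C, Polynomial.eval_X]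
        calc _ = ((z - a) * (z⁻¹ - a)) * ((s.map fun a => z - a).prod *
            (s.map fun a => z⁻¹ - a).prod) := by ring
          _ = _ := by rw [h, h1]; ring
  have hs := IsAlgClosed.splits P
  obtain ⟨F, hF0, hF⟩ := key P.roots
  refine ⟨F, hF0, fun z w hz hw hzw => ?_⟩
  rw [hs.eval_eq_prod_roots_of_monic hP, hs.eval_eq_prod_roots_of_monic hP, hF z w hz hw hzw,
    hs.natDegree_eq_card_roots]

/-! ### Lower bound from the mean value property. -/

theorem norm_eval_zero_le_integral (H : ℂ[X]) :
    2 * Real.pi * ‖H.eval 0‖ ≤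
      ∫ τ in (-Real.pi)..Real.pi, ‖H.eval (Complex.exp (τ * Complex.I))‖ := by
  have h := DiffContOnCl.circleAverage (f := fun z => H.eval z) (c := 0) (R := 1)
    (Differentiable.diffContOnCl H.differentiable)
  have hper : Function.Periodic (fun τ : ℝ => H.eval (Complex.exp (τ * Complex.I)))
      (2 * Real.pi) := by
    intro τ
    simp only
    congr 1
    push_cast
    rw [add_mul, Complex.exp_add, Complex.exp_two_pi_mul_I, mul_one]
  have h2 := hper.intervalIntegral_add_eq 0 (-Real.pi)
  rw [Real.circleAverage_def] at h
  simp only [circleMap_zero, Complex.ofReal_one, one_mul] at h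
  rw [zero_add, show -Real.pi + 2 * Real.pi = Real.pi by ring] at h2
  have hpi := Real.pi_pos
  have h3 := intervalIntegral.norm_integral_le_integral_norm (μ := MeasureTheory.volume)
    (f := fun τ : ℝ => H.eval (Complex.exp (τ * Complex.I)))
    (by linarith : -Real.pi ≤ Real.pi)
  rw [← h2] at h3
  refine le_trans (le_of_eq ?_) h3
  rw [← h, norm_smul, Real.norm_of_nonneg (by positivity)]
  rw [← mul_assoc, mul_inv_cancel₀ (by positivity), one_mul]

/-- On the unit circle `1/w` is the conjugate of `w`, so conjugating the coefficients of `F` trades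
`F(1/w)` for a polynomial in `w`; also `|1 + w| = 2 cos t`. -/
theorem norm_mul_norm_conj_eq (F : ℂ[X]) (t : ℝ) (ht : 0 ≤ Real.cos t) :
    ‖F.eval (Complex.exp ((2 * t : ℝ) * Complex.I)) *
        F.eval (Complex.exp ((2 * t : ℝ) * Complex.I))⁻¹‖ * Real.cos t
      = ‖(F * F.map (starRingEnd ℂ) * (1 + Polynomial.X)).eval
          (Complex.exp ((2 * t : ℝ) * Complex.I))‖ / 2 := by
  set w := Complex.exp ((2 * t : ℝ) * Complex.I) with hw
  have hconj : (starRingEnd ℂ) w = w⁻¹ := by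
    rw [Complex.inv_def, Complex.normSq_eq_norm_sq, hw, Complex.norm_exp_ofReal_mul_I]
    simp
  have h1 : (F.map (starRingEnd ℂ)).eval w = (starRingEnd ℂ) (F.eval w⁻¹) := by
    rw [← hconj, ← Polynomial.eval_map_apply, Complex.conj_conj]
  have h2 : ‖1 + w‖ = 2 * Real.cos t := by
    have e : 1 + w = (2 * Real.cos t : ℝ) * Complex.exp (t * Complex.I) := by
      have hw' : w = Complex.exp (t * Complex.I) * Complex.exp (t * Complex.I) := by
        rw [hw, ← Complex.exp_add]; push_cast; ring_nf
      have hinv : Complex.exp (t * Complex.I) * Complex.exp (-t * Complex.I) = 1 := by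
        rw [← Complex.exp_add]; simp
      push_cast
      rw [Complex.cos, hw', ← hinv]
      ring
    rw [e, norm_mul, Complex.norm_exp_ofReal_mul_I, Complex.norm_real,
      Real.norm_of_nonneg (by positivity), mul_one]
  rw [Polynomial.eval_mul, Polynomial.eval_mul, Polynomial.eval_add, Polynomial.eval_one,
    Polynomial.eval_X, norm_mul, norm_mul, norm_mul, h1, h2, Complex.norm_conj]
  ring

/-- Turns `sin (θ/2) = c sin t` into the relation between `z` and `w` required by
`exists_arc_factor`. -/
theorem two_sub_exp_sub_inv (θ : ℝ) :
    2 - Complex.exp (θ * Complex.I) - (Complex.exp (θ * Complex.I))⁻¹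
      = ((4 * Real.sin (θ / 2) ^ 2 : ℝ) : ℂ) := by
  have h : (2 : ℂ) * Complex.cos θ = Complex.exp (θ * Complex.I) +
      (Complex.exp (θ * Complex.I))⁻¹ := by
    rw [← Complex.exp_neg, Complex.cos]; ring_nf
  have h2 : Real.cos θ = 1 - 2 * Real.sin (θ / 2) ^ 2 := by
    have h3 := Real.cos_two_mul (θ / 2)
    rw [mul_div_cancel₀ _ (by norm_num : (2 : ℝ) ≠ 0)] at h3
    rw [h3, Real.cos_sq']
    ring
  have h3 : (4 : ℝ) * Real.sin (θ / 2) ^ 2 = 2 - 2 * Real.cos θ := by rw [h2]; ring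
  rw [h3]
  push_cast
  rw [h]
  ring

/-- The substitution `sin (θ/2) = c sin t`, under which `dt/π` is the equilibrium measure. -/
theorem arcAngle_hasDerivAt {c : ℝ} (hc0 : 0 < c) (hc1 : c < 1) (t : ℝ) :
    HasDerivAt (fun t => 2 * Real.arcsin (c * Real.sin t))
      (2 * (1 / √(1 - (c * Real.sin t) ^ 2) * (c * Real.cos t))) t := by
  have h1 : |c * Real.sin t| < 1 := by
    rw [abs_mul, abs_of_pos hc0]
    nlinarith [Real.abs_sin_le_one t, abs_nonneg (Real.sin t)]
  obtain ⟨h2, h3⟩ := abs_lt.1 h1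
  exact ((Real.hasDerivAt_arcsin h2.ne' h3.ne).comp t
    ((Real.hasDerivAt_sin t).const_mul c)).const_mul 2

theorem le_integral_norm_sq_mul_cos {c : ℝ} (hc0 : 0 < c) (hc1 : c < 1) (P : ℂ[X])
    (hP : P.Monic) :
    c ^ (2 * P.natDegree) * (Real.pi / 2) ≤ ∫ t in (-(Real.pi / 2))..(Real.pi / 2),
      ‖P.eval (Complex.exp ((2 * Real.arcsin (c * Real.sin t) : ℝ) * Complex.I))‖ ^ 2
        * Real.cos t := by
  have hpi := Real.pi_pos
  obtain ⟨F, hF0, hF⟩ := exists_arc_factor hc0 hc1 P hP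
  set H := F * F.map (starRingEnd ℂ) * (1 + Polynomial.X) with hH
  set g : ℝ → ℝ := fun t =>
    ‖P.eval (Complex.exp ((2 * Real.arcsin (c * Real.sin t) : ℝ) * Complex.I))‖ ^ 2 with hg
  have hgc : Continuous g := by fun_prop
  -- Pairing `t` with `-t` pairs `z` with `1/z`, and `x² + y² ≥ 2xy` produces the product that
  -- factors.
  have hpt : ∀ t ∈ Set.Icc (-(Real.pi / 2)) (Real.pi / 2),
      c ^ (2 * P.natDegree) * ‖H.eval (Complex.exp ((2 * t : ℝ) * Complex.I))‖
        ≤ g t * Real.cos t + g (-t) * Real.cos (-t) := by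
    intro t ht
    have hcos : 0 ≤ Real.cos t := Real.cos_nonneg_of_mem_Icc ht
    set θ := 2 * Real.arcsin (c * Real.sin t) with hθ
    have hsin : Real.sin (θ / 2) = c * Real.sin t := by
      rw [hθ, mul_div_cancel_left₀ _ (by norm_num : (2 : ℝ) ≠ 0)]
      exact Real.sin_arcsin (by nlinarith [Real.neg_one_le_sin t, Real.sin_le_one t])
        (by nlinarith [Real.neg_one_le_sin t, Real.sin_le_one t])
    have hrel := hF (Complex.exp (θ * Complex.I)) (Complex.exp ((2 * t : ℝ) * Complex.I))
      (Complex.exp_ne_zero _) (Complex.exp_ne_zero _) (by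
        rw [two_sub_exp_sub_inv, two_sub_exp_sub_inv, hsin,
          mul_div_cancel_left₀ _ (by norm_num : (2 : ℝ) ≠ 0)]
        push_cast
        ring)
    have hgneg : g (-t) = ‖P.eval (Complex.exp (θ * Complex.I))⁻¹‖ ^ 2 := by
      simp only [hg, Real.sin_neg, mul_neg, Real.arcsin_neg]
      rw [← hθ, ← Complex.exp_neg]
      push_cast
      rw [neg_mul]
    have hgt : g t = ‖P.eval (Complex.exp (θ * Complex.I))‖ ^ 2 := rfl
    have hnorm := congrArg norm hrel
    rw [norm_mul, norm_mul _ (F.eval _ * _), norm_pow, Complex.norm_real,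
      Real.norm_of_nonneg hc0.le] at hnorm
    have hmean := norm_mul_norm_conj_eq F t hcos
    rw [← hH] at hmean
    rw [Real.cos_neg, hgneg, hgt]
    calc _ = 2 * (c ^ (2 * P.natDegree) *
          ‖F.eval (Complex.exp ((2 * t : ℝ) * Complex.I)) *
            F.eval (Complex.exp ((2 * t : ℝ) * Complex.I))⁻¹‖) * Real.cos t := by
          linear_combination (-2 * c ^ (2 * P.natDegree)) * hmean
      _ = 2 * (‖P.eval (Complex.exp (θ * Complex.I))‖ *
            ‖P.eval (Complex.exp (θ * Complex.I))⁻¹‖) * Real.cos t := by rw [← hnorm]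
      _ ≤ _ := by
        rw [← add_mul]
        gcongr
        nlinarith [sq_nonneg (‖P.eval (Complex.exp (θ * Complex.I))‖ -
          ‖P.eval (Complex.exp (θ * Complex.I))⁻¹‖)]
  have hint := intervalIntegral.integral_mono_on (μ := MeasureTheory.volume)
    (by linarith : -(Real.pi / 2) ≤ Real.pi / 2)
    (Continuous.intervalIntegrable (by fun_prop) _ _)
    (Continuous.intervalIntegrable (by fun_prop) _ _) hpt
  rw [intervalIntegral.integral_add (Continuous.intervalIntegrable (by fun_prop) _ _)
    (Continuous.intervalIntegrable (by fun_prop) _ _),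
    intervalIntegral.integral_comp_neg (fun t => g t * Real.cos t), neg_neg,
    intervalIntegral.integral_const_mul,
    intervalIntegral.integral_comp_mul_left
      (fun τ : ℝ => ‖H.eval (Complex.exp (τ * Complex.I))‖) two_ne_zero,
    show 2 * -(Real.pi / 2) = -Real.pi by ring, show 2 * (Real.pi / 2) = Real.pi by ring,
    smul_eq_mul] at hint
  -- Here `|H(0)| = |F(0)|²`.
  have hH0 : 1 ≤ ‖H.eval 0‖ := by
    have : (F.map (starRingEnd ℂ)).eval 0 = (starRingEnd ℂ) (F.eval 0) := by
      rw [← Polynomial.eval_map_apply, map_zero]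
    simp only [hH, Polynomial.eval_mul, Polynomial.eval_add, Polynomial.eval_one,
      Polynomial.eval_X, this, norm_mul, Complex.norm_conj, add_zero, mul_one]
    nlinarith
  have hmv := norm_eval_zero_le_integral H
  have hmv' : Real.pi ≤ 2⁻¹ * ∫ τ in (-Real.pi)..Real.pi,
      ‖H.eval (Complex.exp (τ * Complex.I))‖ := by nlinarith
  have := mul_le_mul_of_nonneg_left hmv' (by positivity : 0 ≤ c ^ (2 * P.natDegree))
  linarith

/-- The lower bound for the norm of an arbitrary monic polynomial. -/
theorem le_arcInner_of_monic {y : ℝ} (hy0 : 0 < y) (hy1 : y < 1 / 2) (P : ℂ[X]) (hP : P.Monic) :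
    Real.sin (Real.pi * y / 2) / (2 * y) * Real.sin (Real.pi * y / 2) ^ (2 * P.natDegree)
      ≤ (arcInner y (fun z => P.eval z) (fun z => P.eval z)).re := by
  have hpi := Real.pi_pos
  have hpy : 0 < Real.pi * y := by positivity
  have hpy' : Real.pi * y < Real.pi / 2 := by nlinarith
  set c := Real.sin (Real.pi * y / 2) with hc
  have hc0 : 0 < c := Real.sin_pos_of_pos_of_lt_pi (by positivity) (by linarith)
  have hc1 : c < 1 := by
    rw [hc, ← Real.sin_pi_div_two]
    exact Real.sin_lt_sin_of_lt_of_le_pi_div_two (by linarith) le_rfl (by linarith)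
  have harc : 2 * Real.arcsin c = Real.pi * y := by
    rw [hc, Real.arcsin_sin (by linarith) (by linarith)]
    ring
  have hpos : ∀ t, 0 < 1 - (c * Real.sin t) ^ 2 := fun t => by
    have h1 : c ^ 2 < 1 := by nlinarith
    have h2 := mul_le_mul_of_nonneg_left (Real.sin_sq_le_one t) (sq_nonneg c)
    rw [mul_pow]
    linarith
  have hcont : Continuous fun t => 2 * (1 / √(1 - (c * Real.sin t) ^ 2) * (c * Real.cos t)) := by
    have : ∀ t, √(1 - (c * Real.sin t) ^ 2) ≠ 0 := fun t => (Real.sqrt_pos.2 (hpos t)).ne'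
    fun_prop (disch := assumption)
  have hsub := intervalIntegral.integral_comp_mul_deriv (a := -(Real.pi / 2)) (b := Real.pi / 2)
    (g := fun θ : ℝ => ‖P.eval (Complex.exp (θ * Complex.I))‖ ^ 2)
    (fun t _ => arcAngle_hasDerivAt hc0 hc1 t) hcont.continuousOn (by fun_prop)
  simp only [Real.sin_neg, Real.sin_pi_div_two, mul_one, mul_neg, Real.arcsin_neg, harc] at hsub
  have hmono := intervalIntegral.integral_mono_on (μ := MeasureTheory.volume)
    (f := fun t => 2 * c *
      (‖P.eval (Complex.exp ((2 * Real.arcsin (c * Real.sin t) : ℝ) * Complex.I))‖ ^ 2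
        * Real.cos t))
    (by linarith : -(Real.pi / 2) ≤ Real.pi / 2)
    (Continuous.intervalIntegrable (by fun_prop) _ _)
    (Continuous.intervalIntegrable (Continuous.mul (by fun_prop) hcont) _ _)
    (g := fun t => ((fun θ : ℝ => ‖P.eval (Complex.exp (θ * Complex.I))‖ ^ 2) ∘
      fun t => 2 * Real.arcsin (c * Real.sin t)) t *
        (2 * (1 / √(1 - (c * Real.sin t) ^ 2) * (c * Real.cos t))))
    (fun t ht => by
      have hcos : 0 ≤ Real.cos t := Real.cos_nonneg_of_mem_Icc ht
      -- The Jacobian is `2c cos t` times this factor, which may be dropped.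
      have h1 : 1 ≤ 1 / √(1 - (c * Real.sin t) ^ 2) := by
        rw [le_div_iff₀ (Real.sqrt_pos.2 (hpos t)), one_mul]
        exact Real.sqrt_le_one.2 (by nlinarith [sq_nonneg (c * Real.sin t)])
      have h2 : c * Real.cos t ≤ 1 / √(1 - (c * Real.sin t) ^ 2) * (c * Real.cos t) :=
        le_mul_of_one_le_left (by positivity) h1
      simp only [Function.comp]
      have h3 := mul_le_mul_of_nonneg_left h2 (sq_nonneg
        ‖P.eval (Complex.exp ((2 * Real.arcsin (c * Real.sin t) : ℝ) * Complex.I))‖)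
      linarith)
  rw [hsub, intervalIntegral.integral_const_mul] at hmono
  have hmain := le_integral_norm_sq_mul_cos hc0 hc1 P hP
  rw [arcInner_self, Complex.ofReal_re]
  have h4 := (mul_le_mul_of_nonneg_left hmain (by positivity : 0 ≤ 2 * c)).trans hmono
  have h5 := mul_le_mul_of_nonneg_left h4 (by positivity : 0 ≤ 1 / (2 * Real.pi * y))
  refine le_trans (le_of_eq ?_) h5
  field_simp

end SzegoArc

theorem mainTheorem6 (y : ℝ) (hy0 : 0 < y) (hy1 : y < 1 / 2) (c : ℝ)
    (hc : c = Real.sin (Real.pi * y / 2)) (n : ℕ) :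
    ∃ k : ℝ, 0 < k ∧ (SzegoArc.szegoPoly y n).natDegree = n ∧
      (SzegoArc.szegoPoly y n).leadingCoeff = (k : ℂ) ∧
      c / (2 * y) * c ^ (2 * n) ≤ k ^ (-2 : ℤ) ∧
      k ^ (-2 : ℤ) ≤ 4 * (1 + 2 * y) ^ 2 * c ^ (2 * n) := by
  have hm := SzegoArc.monicSzego_monic y n
  have hpos := SzegoArc.arcInner_self_pos y hy0 (by linarith) _ hm.ne_zero
  set N := SzegoArc.arcNorm y (fun z => (SzegoArc.monicSzego y n).eval z) with hN
  have hN0 : 0 < N := Real.sqrt_pos.2 hpos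
  have hsq : (N⁻¹) ^ (-2 : ℤ) = (SzegoArc.arcInner y
      (fun z => (SzegoArc.monicSzego y n).eval z)
      (fun z => (SzegoArc.monicSzego y n).eval z)).re := by
    rw [zpow_neg, inv_zpow, inv_inv]
    exact Real.sq_sqrt hpos.le
  have hNC : ((N⁻¹ : ℝ) : ℂ) ≠ 0 := by exact_mod_cast (inv_pos.2 hN0).ne'
  refine ⟨N⁻¹, inv_pos.2 hN0, ?_, ?_, ?_, ?_⟩
  · rw [SzegoArc.szegoPoly, Polynomial.natDegree_C_mul hNC, SzegoArc.monicSzego_natDegree]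
  · rw [SzegoArc.szegoPoly, Polynomial.leadingCoeff_mul, hm.leadingCoeff,
      Polynomial.leadingCoeff_C, mul_one]
  · have h := SzegoArc.le_arcInner_of_monic hy0 hy1 _ hm
    rw [SzegoArc.monicSzego_natDegree] at h
    rwa [hsq, hc]
  · rw [hsq, hc]
    -- The bound `4 c^{2n}` is already sharper; only `1 ≤ (1 + 2y)²` remains.
    refine (SzegoArc.arcInner_monicSzego_le_four_mul hy0 hy1 n).trans ?_
    have : 0 ≤ Real.sin (Real.pi * y / 2) ^ (2 * n) := by rw [pow_mul]; positivity
    gcongr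
    nlinarith
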